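/- Let $M$ be a (Hausdorff) differentiable manifold of class $C^\infty$ of finite dimension, with tangent bundle $TM$, and let $\nabla$ be a smooth affine connection on $M$ (torsion is allowed). Let $\alpha,\beta$ be positive integers. A metallic structure with parameters $\alpha,\beta$ on a manifold is a smooth tensor field $\Psi$ of type $(1,1)$ with $\Psi^2-\alpha\Psi-\beta I=0$. For a smooth $(1,1)$ tensor field $\Psi$ on $M$ with local components $\Psi^h_i$, and with respect to the coordinates $(x^h,y^h)$ on $TM$ induced by local coordinates $(x^h)$ on $M$, let the complete lift $\Psi^C$, the tensor field $\nabla_\gamma\Psi$ and the horizontal lift $\Psi^H$ be the $(1,1)$ tensor fields on $TM$ given by $$\Psi^C=\begin{pmatrix}\Psi^h_i&0\\ y^l\partial_l\Psi^h_i&\Psi^h_i\end{pmatrix},\qquad \nabla_\gamma\Psi=y^l\,(\nabla_l\Psi^h_i)\,\frac{\partial}{\partial y^h}\otimes dx^i,\qquad \Psi^H=\Psi^C-\nabla_\gamma\Psi .$$ **Theorem 5.1.** If $\Psi$ is a metallic structure on $M$ with parameters $\alpha,\beta$, then the horizontal lift $\Psi^H$ is a metallic structure on $TM$ with the same parameters;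 that is, $\Psi^H$ is a smooth $(1,1)$ tensor field on $TM$ and $$(\Psi^H)^2-\alpha\Psi^H-\beta I=0 .$$ -/

import Mathlib

open Bundle
open scoped Manifold ContDiff

noncomputable section

section TensorFields

variable {E : Type*} [NormedAddCommGroup E] [NormedSpace ℝ E]
  {H : Type*} [TopologicalSpace H] (I : ModelWithCorners ℝ E H)
  {M : Type*} [TopologicalSpace M] [ChartedSpace H M]

/-- A field `x ↦ Ψ x` of endomorphisms of the tangent spaces of `M` is a smooth tensor field of
type `(1, 1)` if it is a `C^∞` section of the bundle `Hom(TM, TM)`. -/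
def IsSmoothTensorField [IsManifold I ∞ M]
    (Ψ : Π x : M, TangentSpace I x →L[ℝ] TangentSpace I x) : Prop :=
  ContMDiff I (I.prod 𝓘(ℝ, E →L[ℝ] E)) ∞
    (fun x : M ↦ (⟨x, Ψ x⟩ :
      TotalSpace (E →L[ℝ] E) (fun y : M ↦ TangentSpace I y →L[ℝ] TangentSpace I y)))

/-- A metallic structure with parameters `α`, `β`: a smooth `(1, 1)` tensor field `Ψ` with
`Ψ² - α Ψ - β I = 0`, the parameters being positive integers. -/
structure IsMetallicStructure [IsManifold I ∞ M] (α β : ℕ)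
    (Ψ : Π x : M, TangentSpace I x →L[ℝ] TangentSpace I x) : Prop where
  alpha_pos : 0 < α
  beta_pos : 0 < β
  smooth : IsSmoothTensorField I Ψ
  equation : ∀ x : M, (Ψ x).comp (Ψ x) - (α : ℝ) • Ψ x
    - (β : ℝ) • ContinuousLinearMap.id ℝ (TangentSpace I x) = 0

variable {I}

/-- Differentiability of `x ↦ Ψ x (W x)`, for `Ψ` smooth and `W` differentiable. -/
theorem IsSmoothTensorField.mdifferentiableAt_apply [IsManifold I ∞ M]
    {Ψ : Π x : M, TangentSpace I x →L[ℝ] TangentSpace I x} (hΨ : IsSmoothTensorField I Ψ)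
    {W : Π x : M, TangentSpace I x} {x : M} (hW : MDiffAt (T% W) x) :
    MDiffAt (T% (fun y ↦ Ψ y (W y))) x :=
  ((hΨ x).mdifferentiableAt (by simp)).clm_bundle_apply hW

/-- For a connection `∇`, a `(1, 1)` tensor field `Ψ` and a tangent vector `v` at `x`, the
operation `W ↦ ∇_v (Ψ W) - Ψ (∇_v W)` is tensorial in the vector field `W`. -/
theorem tensorialAt_covariantDerivative_tensorField [IsManifold I ∞ M]
    (cov : CovariantDerivative I E (TangentSpace I : M → Type _))
    {Ψ : Π x : M, TangentSpace I x →L[ℝ] TangentSpace I x} (hΨ : IsSmoothTensorField I Ψ)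
    (x : M) (v : TangentSpace I x) :
    TensorialAt I E (fun W : Π y : M, TangentSpace I y ↦
      cov (fun y ↦ Ψ y (W y)) x v - Ψ x (cov W x v)) x where
  smul {f W} hf hW := by
    have h1 : (fun y ↦ Ψ y ((f • W) y)) = f • (fun y ↦ Ψ y (W y)) := by
      ext y
      simp
    rw [h1, cov.isCovariantDerivativeOnUniv.leibniz (hΨ.mdifferentiableAt_apply hW) hf,
      cov.isCovariantDerivativeOnUniv.leibniz hW hf]
    simp
    module
  add {W W'} hW hW' := by
    have h1 : (fun y ↦ Ψ y ((W + W') y)) = (fun y ↦ Ψ y (W y)) + (fun y ↦ Ψ y (W' y)) := by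
      ext y
      simp
    rw [h1, cov.isCovariantDerivativeOnUniv.add (hΨ.mdifferentiableAt_apply hW)
      (hΨ.mdifferentiableAt_apply hW'), cov.isCovariantDerivativeOnUniv.add hW hW']
    simp
    module

/-- The covariant derivative `∇_v Ψ` of a `(1, 1)` tensor field in the direction of `v ∈ T_x M`:
the endomorphism of `T_x M` with `(∇_v Ψ) (W x) = ∇_v (Ψ W) - Ψ (∇_v W)` for vector fields `W`. -/
def covariantDerivativeTensor [IsManifold I ∞ M] [FiniteDimensional ℝ E]
    (cov : CovariantDerivative I E (TangentSpace I : M → Type _))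
    (Ψ : Π x : M, TangentSpace I x →L[ℝ] TangentSpace I x) (hΨ : IsSmoothTensorField I Ψ)
    (x : M) (v : TangentSpace I x) : TangentSpace I x →L[ℝ] TangentSpace I x :=
  TensorialAt.mkHom (fun W : Π y : M, TangentSpace I y ↦
    cov (fun y ↦ Ψ y (W y)) x v - Ψ x (cov W x v)) x
    (tensorialAt_covariantDerivative_tensorField cov hΨ x v)

/-- The components `Ψ^h_i` of `Ψ` in the chart of `M` around `x₀`, as a function with values in
the endomorphisms of the model space (meaningful at the points `x` of the chart domain). -/
def tensorComponents [IsManifold I ∞ M]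
    (Ψ : Π x : M, TangentSpace I x →L[ℝ] TangentSpace I x) (x₀ x : M) : E →L[ℝ] E :=
  ContinuousLinearMap.inCoordinates E (TangentSpace I : M → Type _)
    E (TangentSpace I : M → Type _) x₀ x x₀ x (Ψ x)

/-- The endomorphism of the tangent space of `TM` at `p` whose matrix in the induced coordinates
`(x^h, y^h)` has the blocks `A`, `B` in the first row and `C`, `D` in the second. The induced
coordinates are those of the chart of `TM` obtained from the preferred chart of `M` around the
base point of `p`; they identify the tangent space at `p` with `E × E`. -/
def inducedBlock [IsManifold I ∞ M] (p : TangentBundle I M) (A B C D : E →L[ℝ] E) :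
    TangentSpace I.tangent p →L[ℝ] TangentSpace I.tangent p :=
  show E × E →L[ℝ] E × E from
    (A.comp (.fst ℝ E E) + B.comp (.snd ℝ E E)).prod (C.comp (.fst ℝ E E) + D.comp (.snd ℝ E E))

/-- The complete lift `Ψ^C`. In induced coordinates its matrix at the point `p = (x, y)` has the
rows `(Ψ^h_i, 0)` and `(∂Ψ^h_i, Ψ^h_i)`, where `∂Ψ^h_i = y^l ∂_l Ψ^h_i` is the derivative at `x`, in
the direction `y`, of the components of `Ψ`. -/
def completeLift [IsManifold I ∞ M]
    (Ψ : Π x : M, TangentSpace I x →L[ℝ] TangentSpace I x) (p : TangentBundle I M) :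
    TangentSpace I.tangent p →L[ℝ] TangentSpace I.tangent p :=
  inducedBlock p (tensorComponents Ψ p.proj p.proj) 0
    (mfderiv I 𝓘(ℝ, E →L[ℝ] E) (tensorComponents Ψ p.proj) p.proj p.snd)
    (tensorComponents Ψ p.proj p.proj)

/-- The tensor field `∇_γ Ψ = y^l ∇_l Ψ^h_i ∂/∂y^h ⊗ dx^i` on `TM`. -/
def gammaLift [IsManifold I ∞ M] [FiniteDimensional ℝ E]
    (cov : CovariantDerivative I E (TangentSpace I : M → Type _))
    (Ψ : Π x : M, TangentSpace I x →L[ℝ] TangentSpace I x) (hΨ : IsSmoothTensorField I Ψ)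
    (p : TangentBundle I M) :
    TangentSpace I.tangent p →L[ℝ] TangentSpace I.tangent p :=
  inducedBlock p 0 0
    (ContinuousLinearMap.inCoordinates E (TangentSpace I : M → Type _)
      E (TangentSpace I : M → Type _) p.proj p.proj p.proj p.proj
      (covariantDerivativeTensor cov Ψ hΨ p.proj p.snd)) 0

/-- The horizontal lift `Ψ^H = Ψ^C - ∇_γ Ψ`. -/
def horizontalLift [IsManifold I ∞ M] [FiniteDimensional ℝ E]
    (cov : CovariantDerivative I E (TangentSpace I : M → Type _))
    (Ψ : Π x : M, TangentSpace I x →L[ℝ] TangentSpace I x) (hΨ : IsSmoothTensorField I Ψ)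
    (p : TangentBundle I M) :
    TangentSpace I.tangent p →L[ℝ] TangentSpace I.tangent p :=
  completeLift Ψ p - gammaLift cov Ψ hΨ p

end TensorFields

end

/-!
In induced coordinates the matrix of `Ψ^H` is `(A, 0; C, A)`, with `A` the components of `Ψ` and
`C = ∂_y A - ∇_y Ψ`. The metallic equation for it amounts to `A² = α A + β` together with
`C A + A C = α C`. Differentiating `Ψ² = α Ψ + β` by coordinates and by `∇` gives the second identity
for each summand of `C`: `IsMetallicStructure.tensorComponentsDeriv_anticomm` and
`IsMetallicStructure.covariantDerivativeTensor_anticomm`.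

For smoothness, the lift is defined at each point through the preferred chart at that point, which
may vary discontinuously. So it has to be shown that in one fixed induced chart the matrix
is again `(A, 0; C, A)`, with `A` and `C` computed in that chart (`inCoordinates_horizontalLift`).
The differential of the chart transition of `TM` is `(φ', 0; φ''(·, y), φ')`
(`tangentCoordChange_tangentBundle`), and its second-order part is matched by the transformation
law of `∂_y A` (`tensorComponentsDeriv_tangentCoordChange`), which uses the symmetry of `φ''`. In the
fixed chart the entries are smooth: `A` because `Ψ` is, `∂_y A` as a derivative applied to the smooth
fibre coordinate `y`, and `∇_y Ψ` by evaluating `∇_y (Ψ W) - Ψ (∇_y W)` on global smooth vector fields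
`W` that have constant components near the given point.
-/

section

open ContinuousLinearMap Filter
open scoped Topology

variable {E : Type*} [NormedAddCommGroup E] [NormedSpace ℝ E]

/-! ### Coordinate changes of the tangent bundle -/

theorem tangentCoordChange_tangentCoordChange {H : Type*} [TopologicalSpace H]
    {I : ModelWithCorners ℝ E H} {N : Type*} [TopologicalSpace N] [ChartedSpace H N]
    [IsManifold I 1 N] {x y z : N} (hx : z ∈ (chartAt H x).source) (hy : z ∈ (chartAt H y).source)
    (v : E) : tangentCoordChange I y x z (tangentCoordChange I x y z v) = v := by
  rw [tangentCoordChange_comp (by simp only [extChartAt_source]; exact ⟨⟨hx, hy⟩, hx⟩)]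
  exact tangentCoordChange_self (by simpa only [extChartAt_source] using hx)

theorem inCoordinates_tangentSpace_eq {H : Type*} [TopologicalSpace H] {I : ModelWithCorners ℝ E H}
    {N : Type*} [TopologicalSpace N] [ChartedSpace H N] [IsManifold I 1 N] {x y : N}
    (hx : y ∈ (chartAt H x).source) (φ : TangentSpace I y →L[ℝ] TangentSpace I y) (v : E) :
    inCoordinates E (TangentSpace I : N → Type _) E (TangentSpace I : N → Type _) x y x y φ v =
      tangentCoordChange I y x y ((φ : E →L[ℝ] E) (tangentCoordChange I x y y v)) :=
  congrArg (fun L : E →L[ℝ] E ↦ L v)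
    ((tangentBundleCore I N).inCoordinates_eq (tangentBundleCore I N) φ hx hx)

/-- In the preferred chart around `y` itself, an endomorphism of `T_y N` is its own coordinate
expression, since `TangentSpace I y` is the model space read in that chart. -/
theorem inCoordinates_tangentSpace_self {H : Type*} [TopologicalSpace H]
    {I : ModelWithCorners ℝ E H} {N : Type*} [TopologicalSpace N] [ChartedSpace H N]
    [IsManifold I 1 N] {y : N} (φ : TangentSpace I y →L[ℝ] TangentSpace I y) (v : E) :
    inCoordinates E (TangentSpace I : N → Type _) E (TangentSpace I : N → Type _) y y y y φ v =
      (φ : E →L[ℝ] E) v := by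
  rw [inCoordinates_tangentSpace_eq (mem_chart_source H y),
    tangentCoordChange_self (mem_extChartAt_source y)]
  exact tangentCoordChange_self (mem_extChartAt_source y)

/-- The coordinate expressions of an endomorphism of `T_y N` in the charts around `x` and `x₀` are
conjugate under the tangent coordinate change. -/
theorem inCoordinates_tangentCoordChange {H : Type*} [TopologicalSpace H]
    {I : ModelWithCorners ℝ E H} {N : Type*} [TopologicalSpace N] [ChartedSpace H N]
    [IsManifold I 1 N] {x x₀ y : N} (hx : y ∈ (chartAt H x).source)
    (hx₀ : y ∈ (chartAt H x₀).source) (φ : TangentSpace I y →L[ℝ] TangentSpace I y) (v : E) :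
    inCoordinates E (TangentSpace I : N → Type _) E (TangentSpace I : N → Type _)
        x₀ y x₀ y φ (tangentCoordChange I x x₀ y v) =
      tangentCoordChange I x x₀ y
        (inCoordinates E (TangentSpace I : N → Type _) E (TangentSpace I : N → Type _)
          x y x y φ v) := by
  rw [inCoordinates_tangentSpace_eq hx₀, inCoordinates_tangentSpace_eq hx,
    tangentCoordChange_comp (by simp [hx, hx₀])]
  exact (tangentCoordChange_comp (by simp [hx, hx₀])).symm

variable {M : Type*} [TopologicalSpace M] [ChartedSpace E M]

theorem mfderiv_eq_fderiv_comp_extChartAt_symm {F : Type*} [NormedAddCommGroup F]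
    [NormedSpace ℝ F] {f : M → F} {x : M} (hf : MDifferentiableAt 𝓘(ℝ, E) 𝓘(ℝ, F) f x) :
    mfderiv 𝓘(ℝ, E) 𝓘(ℝ, F) f x =
      fderiv ℝ (f ∘ (extChartAt 𝓘(ℝ, E) x).symm) (extChartAt 𝓘(ℝ, E) x x) := by
  rw [hf.mfderiv, writtenInExtChartAt]
  simp only [modelWithCornersSelf_coe, Set.range_id, fderivWithin_univ]
  rfl

theorem differentiableAt_comp_extChartAt_symm {F : Type*} [NormedAddCommGroup F]
    [NormedSpace ℝ F] {f : M → F} {x : M} (hf : MDifferentiableAt 𝓘(ℝ, E) 𝓘(ℝ, F) f x) :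
    DifferentiableAt ℝ (f ∘ (extChartAt 𝓘(ℝ, E) x).symm) (extChartAt 𝓘(ℝ, E) x x) := by
  have h := ((mdifferentiableAt_iff _ _).1 hf).2
  simp only [modelWithCornersSelf_coe, Set.range_id, differentiableWithinAt_univ] at h
  exact h

variable [IsManifold 𝓘(ℝ, E) ∞ M]

theorem contDiffAt_chartTransition {x x₀ y : M} (hx : y ∈ (chartAt E x).source)
    (hx₀ : y ∈ (chartAt E x₀).source) :
    ContDiffAt ℝ ∞ (extChartAt 𝓘(ℝ, E) x₀ ∘ (extChartAt 𝓘(ℝ, E) x).symm)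
      (extChartAt 𝓘(ℝ, E) x y) := by
  have := contDiffWithinAt_ext_coord_change (I := 𝓘(ℝ, E)) (n := ∞) x₀ x
    (y := extChartAt 𝓘(ℝ, E) x y) (by simp [hx, hx₀])
  simpa only [modelWithCornersSelf_coe, Set.range_id, contDiffWithinAt_univ] using this

theorem tangentCoordChange_symm_eq_fderiv {x x₀ : M} {z : E}
    (hz : z ∈ (extChartAt 𝓘(ℝ, E) x).target) :
    tangentCoordChange 𝓘(ℝ, E) x x₀ ((extChartAt 𝓘(ℝ, E) x).symm z) =
      fderiv ℝ (extChartAt 𝓘(ℝ, E) x₀ ∘ (extChartAt 𝓘(ℝ, E) x).symm) z := by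
  rw [tangentCoordChange_def, (extChartAt 𝓘(ℝ, E) x).right_inv hz]
  simp [fderivWithin_univ]

/-- The tangent coordinate change of `TM`. A change of charts `φ` of `M` induces the change of
charts `(x, y) ↦ (φ x, φ' x y)` of `TM`, whose derivative at `(x, y)` is
`(h, k) ↦ (φ' h, φ'' h y + φ' k)`. -/
theorem tangentCoordChange_tangentBundle (p p₀ : TangentBundle 𝓘(ℝ, E) M)
    (hp : p.proj ∈ (chartAt E p₀.proj).source) (w : E × E) :
    tangentCoordChange 𝓘(ℝ, E).tangent p p₀ p w =
      (tangentCoordChange 𝓘(ℝ, E) p.proj p₀.proj p.proj w.1,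
        fderiv ℝ (fderiv ℝ (extChartAt 𝓘(ℝ, E) p₀.proj ∘ (extChartAt 𝓘(ℝ, E) p.proj).symm))
          (extChartAt 𝓘(ℝ, E) p.proj p.proj) w.1 (p.snd : E) +
        tangentCoordChange 𝓘(ℝ, E) p.proj p₀.proj p.proj w.2) := by
  set χ := extChartAt 𝓘(ℝ, E) p.proj
  set φ := extChartAt 𝓘(ℝ, E) p₀.proj ∘ χ.symm
  -- The fibre coordinate as an element of `E`, without reference to the tangent space at `p.proj`.
  obtain ⟨y, hy⟩ : ∃ y : E, y = p.snd := ⟨_, rfl⟩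
  rw [← hy]
  have hsm : ContDiffAt ℝ ∞ φ (χ p.proj) :=
    contDiffAt_chartTransition (mem_chart_source E p.proj) hp
  have hJ : tangentCoordChange 𝓘(ℝ, E) p.proj p₀.proj p.proj = fderiv ℝ φ (χ p.proj) := by
    simp [fderivWithin_univ, φ, χ]
  have hpt : extChartAt 𝓘(ℝ, E).tangent p p = (χ p.proj, y) := by
    refine Prod.ext ?_ ?_
    · rfl
    · rw [hy]
      exact tangentCoordChange_self (mem_extChartAt_source (I := 𝓘(ℝ, E)) p.proj)
  -- The change of charts of `TM` is `(x, y) ↦ (φ x, φ' x y)`.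
  have hev : extChartAt 𝓘(ℝ, E).tangent p₀ ∘ (extChartAt 𝓘(ℝ, E).tangent p).symm
      =ᶠ[𝓝 (χ p.proj, y)] fun q : E × E ↦ (φ q.1, fderiv ℝ φ q.1 q.2) := by
    have : ∀ᶠ q : E × E in 𝓝 (χ p.proj, y), q.1 ∈ χ.target :=
      continuousAt_fst.eventually (extChartAt_target_mem_nhds (I := 𝓘(ℝ, E)) p.proj)
    have h' : ∀ᶠ q : E × E in 𝓝 (χ p.proj, y),
        χ.symm q.1 ∈ (extChartAt 𝓘(ℝ, E) p₀.proj).source := by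
      have hc : ContinuousAt χ.symm (χ p.proj) := continuousAt_extChartAt_symm p.proj
      have h2 : (extChartAt 𝓘(ℝ, E) p₀.proj).source ∈ 𝓝 (χ.symm (χ p.proj)) := by
        rw [extChartAt_to_inv]
        exact extChartAt_source_mem_nhds' (by simpa using hp)
      exact (hc.comp (f := Prod.fst) (x := (χ p.proj, y)) continuousAt_fst).eventually h2
    filter_upwards [this, h'] with q hq hq'
    have hqs := χ.map_target hq
    refine Prod.ext ?_ ?_
    · rfl
    · rw [← tangentCoordChange_symm_eq_fderiv hq]
      exact tangentCoordChange_comp (w := p.proj) (x := χ.symm q.1) (y := p₀.proj)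
        ⟨⟨hqs, mem_extChartAt_source (I := 𝓘(ℝ, E)) (χ.symm q.1)⟩, hq'⟩
  clear_value φ
  have hd1 : HasFDerivAt φ (fderiv ℝ φ (χ p.proj)) (χ p.proj) :=
    (hsm.differentiableAt (by simp)).hasFDerivAt
  have hd2 : HasFDerivAt (fderiv ℝ φ) (fderiv ℝ (fderiv ℝ φ) (χ p.proj)) (χ p.proj) :=
    ((hsm.fderiv_right (m := 1) (by norm_cast)).differentiableAt (by simp)).hasFDerivAt
  have hd : HasFDerivAt (fun q : E × E ↦ (φ q.1, fderiv ℝ φ q.1 q.2)) _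
      (χ p.proj, y) :=
    (hd1.comp (χ p.proj, y) hasFDerivAt_fst).prodMk
    ((hd2.comp (χ p.proj, y) hasFDerivAt_fst).clm_apply hasFDerivAt_snd)
  rw [tangentCoordChange_def, hJ]
  simp only [modelWithCornersSelf_coe, ModelWithCorners.range_prod, Set.range_id, Set.univ_prod_univ,
    fderivWithin_univ]
  rw [hpt, hev.fderiv_eq, hd.fderiv]
  simp [add_comm]

/-! ### Components of a tensor field and their derivatives -/

theorem IsSmoothTensorField.contMDiffAt_tensorComponents
    {Ψ : Π x : M, TangentSpace 𝓘(ℝ, E) x →L[ℝ] TangentSpace 𝓘(ℝ, E) x}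
    (hΨ : IsSmoothTensorField 𝓘(ℝ, E) Ψ) {x₀ y : M} (hy : y ∈ (chartAt E x₀).source) :
    ContMDiffAt 𝓘(ℝ, E) 𝓘(ℝ, E →L[ℝ] E) ∞ (tensorComponents Ψ x₀) y := by
  refine ((Trivialization.contMDiffAt_iff (e := trivializationAt (E →L[ℝ] E)
    (fun y : M ↦ TangentSpace 𝓘(ℝ, E) y →L[ℝ] TangentSpace 𝓘(ℝ, E) y) x₀) ?_).1 (hΨ y)).2
  exact ⟨hy, hy⟩

/-- The derivative at `x`, in the direction `v`, of the components of `Ψ` in the chart around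
`x₀`. -/
noncomputable def tensorComponentsDeriv
    (Ψ : Π x : M, TangentSpace 𝓘(ℝ, E) x →L[ℝ] TangentSpace 𝓘(ℝ, E) x)
    (x₀ x : M) (v : E) : E →L[ℝ] E :=
  mfderiv 𝓘(ℝ, E) 𝓘(ℝ, E →L[ℝ] E) (tensorComponents Ψ x₀) x v

theorem IsSmoothTensorField.hasFDerivAt_tensorComponents
    {Ψ : Π x : M, TangentSpace 𝓘(ℝ, E) x →L[ℝ] TangentSpace 𝓘(ℝ, E) x}
    (hΨ : IsSmoothTensorField 𝓘(ℝ, E) Ψ) {x₀ x : M} (hx : x ∈ (chartAt E x₀).source) :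
    ∃ L : E →L[ℝ] E →L[ℝ] E, HasFDerivAt (tensorComponents Ψ x₀ ∘ (extChartAt 𝓘(ℝ, E) x).symm) L
      (extChartAt 𝓘(ℝ, E) x x) ∧ ∀ v, tensorComponentsDeriv Ψ x₀ x v = L v := by
  have hm := (hΨ.contMDiffAt_tensorComponents hx).mdifferentiableAt (by simp)
  refine ⟨_, (differentiableAt_comp_extChartAt_symm hm).hasFDerivAt, fun v ↦ ?_⟩
  exact congrArg (fun L : E →L[ℝ] E →L[ℝ] E ↦ L v) (mfderiv_eq_fderiv_comp_extChartAt_symm hm)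

/-- The transformation law of the derivative of the components, obtained by differentiating the
conjugation law `A₀ φ' = φ' A` in the direction `v`. The symmetry of `φ''` puts the second-derivative
terms into the form in which they occur in `tangentCoordChange_tangentBundle`, with `v` as last
argument. -/
theorem tensorComponentsDeriv_tangentCoordChange
    {Ψ : Π x : M, TangentSpace 𝓘(ℝ, E) x →L[ℝ] TangentSpace 𝓘(ℝ, E) x}
    (hΨ : IsSmoothTensorField 𝓘(ℝ, E) Ψ) {x x₀ : M} (hx : x ∈ (chartAt E x₀).source) (v h : E) :
    tensorComponentsDeriv Ψ x₀ x v
        (tangentCoordChange 𝓘(ℝ, E) x x₀ x h) +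
      tensorComponents Ψ x₀ x
        (fderiv ℝ (fderiv ℝ (extChartAt 𝓘(ℝ, E) x₀ ∘ (extChartAt 𝓘(ℝ, E) x).symm))
          (extChartAt 𝓘(ℝ, E) x x) h v) =
    fderiv ℝ (fderiv ℝ (extChartAt 𝓘(ℝ, E) x₀ ∘ (extChartAt 𝓘(ℝ, E) x).symm))
          (extChartAt 𝓘(ℝ, E) x x) (tensorComponents Ψ x x h) v +
      tangentCoordChange 𝓘(ℝ, E) x x₀ x
        (tensorComponentsDeriv Ψ x x v h) := by
  have hxx := mem_chart_source E x
  have hsm := contDiffAt_chartTransition hxx hx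
  have hinv : (extChartAt 𝓘(ℝ, E) x).symm (extChartAt 𝓘(ℝ, E) x x) = x := extChartAt_to_inv x
  have hT := tangentCoordChange_symm_eq_fderiv (x₀ := x₀)
    (mem_extChartAt_target (I := 𝓘(ℝ, E)) x)
  rw [hinv] at hT
  obtain ⟨L₀, hB₀, hL₀⟩ := hΨ.hasFDerivAt_tensorComponents hx
  obtain ⟨L, hB, hL⟩ := hΨ.hasFDerivAt_tensorComponents hxx
  rw [hT, hL₀, hL]
  have hev : ∀ᶠ z in 𝓝 (extChartAt 𝓘(ℝ, E) x x),
      (tensorComponents Ψ x₀ ∘ (extChartAt 𝓘(ℝ, E) x).symm) z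
        (fderiv ℝ (extChartAt 𝓘(ℝ, E) x₀ ∘ (extChartAt 𝓘(ℝ, E) x).symm) z h) =
      fderiv ℝ (extChartAt 𝓘(ℝ, E) x₀ ∘ (extChartAt 𝓘(ℝ, E) x).symm) z
        ((tensorComponents Ψ x ∘ (extChartAt 𝓘(ℝ, E) x).symm) z h) := by
    have h2 : (extChartAt 𝓘(ℝ, E) x₀).source ∈
        𝓝 ((extChartAt 𝓘(ℝ, E) x).symm (extChartAt 𝓘(ℝ, E) x x)) := by
      rw [hinv]
      exact extChartAt_source_mem_nhds' (by simpa using hx)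
    filter_upwards [extChartAt_target_mem_nhds (I := 𝓘(ℝ, E)) x,
      (continuousAt_extChartAt_symm x).eventually h2] with z hz hz₀
    have hzs := (extChartAt 𝓘(ℝ, E) x).map_target hz
    rw [← tangentCoordChange_symm_eq_fderiv hz]
    rw [extChartAt_source] at hzs
    refine inCoordinates_tangentCoordChange hzs ?_ _ h
    simpa using! hz₀
  have hBx : (tensorComponents Ψ x ∘ (extChartAt 𝓘(ℝ, E) x).symm) (extChartAt 𝓘(ℝ, E) x x) =
    tensorComponents Ψ x x := congrArg _ hinv
  have hBx₀ : (tensorComponents Ψ x₀ ∘ (extChartAt 𝓘(ℝ, E) x).symm) (extChartAt 𝓘(ℝ, E) x x) =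
    tensorComponents Ψ x₀ x := congrArg _ hinv
  rw [← hBx, ← hBx₀]
  generalize tensorComponents Ψ x₀ ∘ (extChartAt 𝓘(ℝ, E) x).symm = B₀ at *
  generalize tensorComponents Ψ x ∘ (extChartAt 𝓘(ℝ, E) x).symm = B at *
  generalize extChartAt 𝓘(ℝ, E) x₀ ∘ (extChartAt 𝓘(ℝ, E) x).symm = φ at *
  generalize extChartAt 𝓘(ℝ, E) x x = e at *
  have hJ : HasFDerivAt (fderiv ℝ φ) (fderiv ℝ (fderiv ℝ φ) e) e :=
    ((hsm.fderiv_right (m := 1) (by norm_cast)).differentiableAt (by simp)).hasFDerivAt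
  have hsymm : IsSymmSndFDerivAt ℝ φ e := hsm.isSymmSndFDerivAt (by
    rw [minSmoothness_of_isRCLikeNormedField]; norm_cast)
  have h1 := hB₀.clm_apply (hJ.clm_apply (hasFDerivAt_const h e))
  have h2 := hJ.clm_apply (hB.clm_apply (hasFDerivAt_const h e))
  have h3 := congrArg (fun L ↦ L v)
    ((h1.congr_of_eventuallyEq (hev.mono fun _ h ↦ h.symm)).unique h2)
  rw [hsymm h v, hsymm _ v]
  simp at h3
  rw [add_comm, h3, add_comm]

/-! ### Derivatives of the metallic equation -/

/-- Near `x₀`, coordinate expressions of endomorphisms of `T_y M` are conjugates under the equivalence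
`T_y M ≃ E` given by the trivialization around `x₀`. -/
theorem exists_inCoordinates_eq_conj {x₀ y : M} (hy : y ∈ (chartAt E x₀).source) :
    ∃ e : TangentSpace 𝓘(ℝ, E) y ≃L[ℝ] E,
      (∀ w, trivializationAt E (TangentSpace 𝓘(ℝ, E)) x₀ ⟨y, w⟩ = (y, e w)) ∧
      ∀ φ : TangentSpace 𝓘(ℝ, E) y →L[ℝ] TangentSpace 𝓘(ℝ, E) y, ∀ v,
        inCoordinates E (TangentSpace 𝓘(ℝ, E) : M → Type _) E (TangentSpace 𝓘(ℝ, E) : M → Type _)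
          x₀ y x₀ y φ v = e (φ (e.symm v)) := by
  refine ⟨(trivializationAt E (TangentSpace 𝓘(ℝ, E)) x₀).continuousLinearEquivAt ℝ y hy,
    fun w ↦ ?_, fun φ v ↦ ?_⟩
  · exact Trivialization.apply_eq_prod_continuousLinearEquivAt ℝ _ y hy w
  · rw [inCoordinates_eq hy hy]
    rfl

variable {Ψ : Π x : M, TangentSpace 𝓘(ℝ, E) x →L[ℝ] TangentSpace 𝓘(ℝ, E) x} {α β : ℕ}

theorem IsMetallicStructure.apply_apply (hΨ : IsMetallicStructure 𝓘(ℝ, E) α β Ψ) (x : M)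
    (w : TangentSpace 𝓘(ℝ, E) x) : Ψ x (Ψ x w) = (α : ℝ) • Ψ x w + (β : ℝ) • w := by
  have h := congrArg (fun L ↦ L w) (hΨ.equation x)
  simp only [_root_.sub_apply, ContinuousLinearMap.comp_apply,
    _root_.smul_apply, ContinuousLinearMap.id_apply,
    _root_.zero_apply] at h
  rw [sub_sub, sub_eq_zero] at h
  exact h

theorem IsMetallicStructure.tensorComponents_apply_apply
    (hΨ : IsMetallicStructure 𝓘(ℝ, E) α β Ψ) {x₀ y : M} (hy : y ∈ (chartAt E x₀).source) (v : E) :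
    tensorComponents Ψ x₀ y (tensorComponents Ψ x₀ y v) =
      (α : ℝ) • tensorComponents Ψ x₀ y v + (β : ℝ) • v := by
  obtain ⟨e, -, he⟩ := exists_inCoordinates_eq_conj hy
  simp only [tensorComponents, he, e.symm_apply_apply, hΨ.apply_apply, map_add, map_smul,
    e.apply_symm_apply]

/-- The derivative of `A² = α A + β` for the components `A` of a metallic structure. -/
theorem IsMetallicStructure.tensorComponentsDeriv_anticomm
    (hΨ : IsMetallicStructure 𝓘(ℝ, E) α β Ψ) (x : M) (v h : E) :
    tensorComponentsDeriv Ψ x x v (tensorComponents Ψ x x h) +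
        tensorComponents Ψ x x (tensorComponentsDeriv Ψ x x v h) =
      (α : ℝ) • tensorComponentsDeriv Ψ x x v h := by
  obtain ⟨L, hB, hL⟩ := hΨ.smooth.hasFDerivAt_tensorComponents (mem_chart_source E x)
  have hinv : (extChartAt 𝓘(ℝ, E) x).symm (extChartAt 𝓘(ℝ, E) x x) = x := extChartAt_to_inv x
  have hev : ∀ᶠ z in 𝓝 (extChartAt 𝓘(ℝ, E) x x),
      (tensorComponents Ψ x ∘ (extChartAt 𝓘(ℝ, E) x).symm) z
        ((tensorComponents Ψ x ∘ (extChartAt 𝓘(ℝ, E) x).symm) z h) =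
      (α : ℝ) • (tensorComponents Ψ x ∘ (extChartAt 𝓘(ℝ, E) x).symm) z h + (β : ℝ) • h := by
    filter_upwards [extChartAt_target_mem_nhds (I := 𝓘(ℝ, E)) x] with z hz
    have hzs := (extChartAt 𝓘(ℝ, E) x).map_target hz
    rw [extChartAt_source] at hzs
    exact hΨ.tensorComponents_apply_apply hzs h
  have hBx : (tensorComponents Ψ x ∘ (extChartAt 𝓘(ℝ, E) x).symm) (extChartAt 𝓘(ℝ, E) x x) =
    tensorComponents Ψ x x := congrArg _ hinv
  rw [hL, ← hBx]
  generalize tensorComponents Ψ x ∘ (extChartAt 𝓘(ℝ, E) x).symm = B at *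
  generalize extChartAt 𝓘(ℝ, E) x x = e at *
  have h0 := hB.clm_apply (hasFDerivAt_const h e)
  have h1 := hB.clm_apply h0
  have h2 := (h0.const_smul (α : ℝ)).add_const ((β : ℝ) • h)
  have h3 := congrArg (fun L ↦ L v) ((h2.congr_of_eventuallyEq hev).unique h1)
  simp at h3
  rw [h3, add_comm]

theorem covariantDerivativeTensor_apply [FiniteDimensional ℝ E]
    (cov : CovariantDerivative 𝓘(ℝ, E) E (TangentSpace 𝓘(ℝ, E) : M → Type _))
    (hΨ : IsSmoothTensorField 𝓘(ℝ, E) Ψ) {x : M} (v : TangentSpace 𝓘(ℝ, E) x)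
    {W : Π x : M, TangentSpace 𝓘(ℝ, E) x} (hW : MDiffAt (T% W) x) :
    covariantDerivativeTensor cov Ψ hΨ x v (W x) =
      cov (fun y ↦ Ψ y (W y)) x v - Ψ x (cov W x v) :=
  TensorialAt.mkHom_apply (tensorialAt_covariantDerivative_tensorField cov hΨ x v) hW

/-- The covariant derivative of `Ψ² = α Ψ + β`. -/
theorem IsMetallicStructure.covariantDerivativeTensor_anticomm [FiniteDimensional ℝ E]
    (hΨ : IsMetallicStructure 𝓘(ℝ, E) α β Ψ)
    (cov : CovariantDerivative 𝓘(ℝ, E) E (TangentSpace 𝓘(ℝ, E) : M → Type _))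
    (x : M) (v w : TangentSpace 𝓘(ℝ, E) x) :
    covariantDerivativeTensor cov Ψ hΨ.smooth x v (Ψ x w) +
        Ψ x (covariantDerivativeTensor cov Ψ hΨ.smooth x v w) =
      (α : ℝ) • covariantDerivativeTensor cov Ψ hΨ.smooth x v w := by
  obtain ⟨W, hW, rfl⟩ : ∃ W : Π y : M, TangentSpace 𝓘(ℝ, E) y, MDiffAt (T% W) x ∧ W x = w :=
    ⟨FiberBundle.extend E w, FiberBundle.mdifferentiableAt_extend .., by simp⟩
  have hΨW := hΨ.smooth.mdifferentiableAt_apply hW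
  rw [covariantDerivativeTensor_apply cov hΨ.smooth v hΨW,
    covariantDerivativeTensor_apply cov hΨ.smooth v hW]
  have h : (fun y ↦ Ψ y (Ψ y (W y))) = (α : ℝ) • (fun y ↦ Ψ y (W y)) + (β : ℝ) • W := by
    ext y
    exact hΨ.apply_apply y (W y)
  have hc := cov.isCovariantDerivativeOnUniv
  rw [h, hc.add (hΨW.smul_const_section) (hW.smul_const_section),
    hc.smul_const _ hΨW, hc.smul_const _ hW]
  simp only [map_sub, hΨ.apply_apply, _root_.add_apply, _root_.smul_apply]
  module

/-! ### Smoothness of the covariant derivative of a tensor field -/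

/-- A map into `E →L[ℝ] F` with `E` finite-dimensional is `C^n` if its values at fixed vectors are. -/
theorem contMDiffAt_clm_of_apply [FiniteDimensional ℝ E] {F : Type*} [NormedAddCommGroup F]
    [NormedSpace ℝ F] {EN : Type*} [NormedAddCommGroup EN] [NormedSpace ℝ EN]
    {HN : Type*} [TopologicalSpace HN] {J : ModelWithCorners ℝ EN HN} {N : Type*}
    [TopologicalSpace N] [ChartedSpace HN N] {n : WithTop ℕ∞} {f : N → E →L[ℝ] F} {p : N}
    (hf : ∀ v, ContMDiffAt J 𝓘(ℝ, F) n (fun q ↦ f q v) p) :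
    ContMDiffAt J 𝓘(ℝ, E →L[ℝ] F) n f p := by
  let b := Module.finBasis ℝ E
  have h : f = fun q ↦ ∑ i, smulRightL ℝ E F (b.coord i).toContinuousLinearMap (f q (b i)) := by
    ext q v
    conv_lhs => rw [← b.sum_repr v, map_sum]
    simp
  rw [h]
  refine ContMDiffAt.sum fun i _ ↦ ?_
  exact (smulRightL ℝ E F (b.coord i).toContinuousLinearMap).contMDiff.contMDiffAt.comp p (hf (b i))

theorem contMDiffAt_snd_trivializationAt (p₀ : TangentBundle 𝓘(ℝ, E) M) :
    ContMDiffAt 𝓘(ℝ, E).tangent 𝓘(ℝ, E) ∞ (fun p : TangentBundle 𝓘(ℝ, E) M ↦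
      (trivializationAt E (TangentSpace 𝓘(ℝ, E)) p₀.proj p).2) p₀ :=
  (contMDiffAt_totalSpace.1 (contMDiffAt_id (x := p₀))).2

/-- Every vector `w` of the model space is the coordinate expression, near `x₀`, of a global smooth
vector field. A global field is needed because smoothness of a connection is tested on those only. -/
theorem exists_contMDiff_section_eq_symm [FiniteDimensional ℝ E] [T2Space M] (x₀ : M) (w : E) :
    ∃ W : Π x : M, TangentSpace 𝓘(ℝ, E) x,
      ContMDiff 𝓘(ℝ, E) 𝓘(ℝ, E).tangent ∞ (T% W) ∧
      ∀ᶠ y in 𝓝 x₀, (trivializationAt E (TangentSpace 𝓘(ℝ, E)) x₀ ⟨y, W y⟩) = (y, w) := by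
  let f : SmoothBumpFunction 𝓘(ℝ, E) x₀ := Classical.arbitrary _
  let t := trivializationAt E (TangentSpace 𝓘(ℝ, E) : M → Type _) x₀
  have hsm : ContMDiffOn 𝓘(ℝ, E) 𝓘(ℝ, E).tangent ∞
      (T% (fun y : M ↦ (t.symm y w : TangentSpace 𝓘(ℝ, E) y))) (chartAt E x₀).source := by
    refine (Trivialization.contMDiffOn_iff (e := t) (fun y hy ↦ t.mem_source.2 hy)).2
      ⟨contMDiffOn_id, (contMDiffOn_const (c := w)).congr fun y hy ↦ ?_⟩
    rw [t.apply_mk_symm hy]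
  refine ⟨(f : M → ℝ) • fun y ↦ t.symm y w,
    ContMDiffOn.smul_section_of_tsupport f.contMDiff.contMDiffOn
    (chartAt E x₀).open_source f.tsupport_subset_chartAt_source hsm, ?_⟩
  filter_upwards [f.eventuallyEq_one, (chartAt E x₀).open_source.mem_nhds (mem_chart_source E x₀)]
    with y hy hys
  have : ((f : M → ℝ) • fun y ↦ t.symm y w) y = t.symm y w := by
    simp [hy]
  rw [this, t.apply_mk_symm hys]

/-- For a smooth connection and a smooth vector field `W` on `M`, the map `y ↦ ∇_y W` is a smooth map
from `TM` to itself. -/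
theorem contMDiffAt_covariantDerivative_snd
    {cov : CovariantDerivative 𝓘(ℝ, E) E (TangentSpace 𝓘(ℝ, E) : M → Type _)}
    (hcov : CovariantDerivative.ContMDiffCovariantDerivative cov ∞)
    {W : Π x : M, TangentSpace 𝓘(ℝ, E) x} (hW : ContMDiff 𝓘(ℝ, E) 𝓘(ℝ, E).tangent ∞ (T% W))
    (p₀ : TangentBundle 𝓘(ℝ, E) M) :
    ContMDiffAt 𝓘(ℝ, E).tangent 𝓘(ℝ, E).tangent ∞ (fun p : TangentBundle 𝓘(ℝ, E) M ↦
      (⟨p.proj, cov W p.proj p.snd⟩ : TangentBundle 𝓘(ℝ, E) M)) p₀ := by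
  have h := contMDiffOn_univ.1 (hcov.contMDiff.contMDiff (σ := W) hW.contMDiffOn)
  have h2 := (h p₀.proj).comp (M := TangentBundle 𝓘(ℝ, E) M) (I := 𝓘(ℝ, E).tangent) p₀
    (contMDiff_proj (n := ∞) (IB := 𝓘(ℝ, E)) (TangentSpace 𝓘(ℝ, E) : M → Type _) p₀)
  exact h2.clm_bundle_apply (v := fun p : TangentBundle 𝓘(ℝ, E) M ↦ p.snd) contMDiffAt_id

/-- Smoothness of the components of `∇_y Ψ` in a fixed chart: their value at `w` is the coordinate
expression of `∇_y (Ψ W) - Ψ (∇_y W)`, for a vector field `W` with constant components `w`. -/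
theorem contMDiffAt_inCoordinates_covariantDerivativeTensor [FiniteDimensional ℝ E] [T2Space M]
    {cov : CovariantDerivative 𝓘(ℝ, E) E (TangentSpace 𝓘(ℝ, E) : M → Type _)}
    (hcov : CovariantDerivative.ContMDiffCovariantDerivative cov ∞)
    {Ψ : Π x : M, TangentSpace 𝓘(ℝ, E) x →L[ℝ] TangentSpace 𝓘(ℝ, E) x}
    (hΨ : IsSmoothTensorField 𝓘(ℝ, E) Ψ) (p₀ : TangentBundle 𝓘(ℝ, E) M) :
    ContMDiffAt 𝓘(ℝ, E).tangent 𝓘(ℝ, E →L[ℝ] E) ∞ (fun p : TangentBundle 𝓘(ℝ, E) M ↦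
      inCoordinates E (TangentSpace 𝓘(ℝ, E) : M → Type _) E (TangentSpace 𝓘(ℝ, E) : M → Type _)
        p₀.proj p.proj p₀.proj p.proj (covariantDerivativeTensor cov Ψ hΨ p.proj p.snd)) p₀ := by
  refine contMDiffAt_clm_of_apply fun w ↦ ?_
  obtain ⟨W, hW, hWw⟩ := exists_contMDiff_section_eq_symm p₀.proj w
  have hΨW : ContMDiff 𝓘(ℝ, E) 𝓘(ℝ, E).tangent ∞ (T% (fun y ↦ Ψ y (W y))) :=
    ContMDiff.clm_bundle_apply hΨ hW
  have h1 := (contMDiffAt_totalSpace.1 (contMDiffAt_covariantDerivative_snd hcov hΨW p₀)).2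
  have h2 := (contMDiffAt_totalSpace.1 (contMDiffAt_covariantDerivative_snd hcov hW p₀)).2
  have hpr := contMDiff_proj (n := ∞) (IB := 𝓘(ℝ, E)) (TangentSpace 𝓘(ℝ, E) : M → Type _) p₀
  have h3 := (hΨ.contMDiffAt_tensorComponents (mem_chart_source E p₀.proj)).comp p₀ hpr
  refine (h1.sub (h3.clm_apply h2)).congr_of_eventuallyEq ?_
  filter_upwards [hpr.continuousAt.eventually hWw, hpr.continuousAt.eventually
    ((chartAt E p₀.proj).open_source.mem_nhds (mem_chart_source E p₀.proj))] with p hp hps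
  obtain ⟨e, he, hφ⟩ := exists_inCoordinates_eq_conj hps
  have hw : w = e (W p.proj) := by
    have := hp.symm.trans (he (W p.proj))
    exact congrArg Prod.snd this
  have hA := covariantDerivativeTensor_apply cov hΨ p.snd ((hW p.proj).mdifferentiableAt (by simp))
  rw [hφ, hw, e.symm_apply_apply, hA]
  simp only [Function.comp_apply, he, tensorComponents, hφ, map_sub, e.symm_apply_apply]

/-! ### The horizontal lift -/

theorem IsSmoothTensorField.contMDiffAt_tensorComponentsDeriv
    (hΨ : IsSmoothTensorField 𝓘(ℝ, E) Ψ) (p₀ : TangentBundle 𝓘(ℝ, E) M) :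
    ContMDiffAt 𝓘(ℝ, E).tangent 𝓘(ℝ, E →L[ℝ] E) ∞ (fun p : TangentBundle 𝓘(ℝ, E) M ↦
      tensorComponentsDeriv Ψ p₀.proj p.proj p.snd) p₀ := by
  have hpr := contMDiff_proj (n := ∞) (IB := 𝓘(ℝ, E)) (TangentSpace 𝓘(ℝ, E) : M → Type _) p₀
  have h1 := ContMDiffAt.mfderiv_const (m := ∞)
    (hΨ.contMDiffAt_tensorComponents (mem_chart_source E p₀.proj)) le_rfl
  have h2 := (h1.comp p₀ hpr).clm_apply (contMDiffAt_snd_trivializationAt p₀)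
  refine h2.congr_of_eventuallyEq ?_
  filter_upwards [hpr.continuousAt.eventually
    ((chartAt E p₀.proj).open_source.mem_nhds (mem_chart_source E p₀.proj))] with p hp
  have hp' : p.proj ∈ (chartAt E p₀.proj).source := hp
  have h0 := inTangentCoordinates_eq (I := 𝓘(ℝ, E)) (I' := 𝓘(ℝ, E →L[ℝ] E)) id
    (tensorComponents Ψ p₀.proj) (mfderiv 𝓘(ℝ, E) 𝓘(ℝ, E →L[ℝ] E) (tensorComponents Ψ p₀.proj))
    (x₀ := p₀.proj) (x := p.proj) hp' (Set.mem_univ _)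
  rw [tangentBundleCore_coordChange_model_space] at h0
  have h4 : tangentCoordChange 𝓘(ℝ, E) p₀.proj p.proj p.proj
      (tangentCoordChange 𝓘(ℝ, E) p.proj p₀.proj p.proj p.snd) = p.snd :=
    tangentCoordChange_tangentCoordChange (E := E) (mem_chart_source E p.proj) hp' p.snd
  exact ((congrArg (fun L : E →L[ℝ] E →L[ℝ] E ↦
    L (tangentCoordChange 𝓘(ℝ, E) p.proj p₀.proj p.proj p.snd)) h0).trans
      (congrArg (tensorComponentsDeriv Ψ p₀.proj p.proj) h4)).symm

/-- The lower left block `∂_y Ψ - ∇_y Ψ` of the matrix of `Ψ^H` at `p = (x, y)`, computed in the chart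
of `M` around `x₀`. -/
noncomputable def horizontalLiftBlock [FiniteDimensional ℝ E]
    (cov : CovariantDerivative 𝓘(ℝ, E) E (TangentSpace 𝓘(ℝ, E) : M → Type _))
    (hΨ : IsSmoothTensorField 𝓘(ℝ, E) Ψ) (x₀ : M) (p : TangentBundle 𝓘(ℝ, E) M) : E →L[ℝ] E :=
  tensorComponentsDeriv Ψ x₀ p.proj p.snd -
    inCoordinates E (TangentSpace 𝓘(ℝ, E) : M → Type _) E (TangentSpace 𝓘(ℝ, E) : M → Type _)
      x₀ p.proj x₀ p.proj (covariantDerivativeTensor cov Ψ hΨ p.proj p.snd)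

theorem horizontalLift_apply [FiniteDimensional ℝ E]
    (cov : CovariantDerivative 𝓘(ℝ, E) E (TangentSpace 𝓘(ℝ, E) : M → Type _))
    (hΨ : IsSmoothTensorField 𝓘(ℝ, E) Ψ) (p : TangentBundle 𝓘(ℝ, E) M) (w : E × E) :
    (horizontalLift cov Ψ hΨ p : E × E →L[ℝ] E × E) w =
      (tensorComponents Ψ p.proj p.proj w.1,
        horizontalLiftBlock cov hΨ p.proj p w.1 + tensorComponents Ψ p.proj p.proj w.2) := by
  have h1 : (completeLift Ψ p : E × E →L[ℝ] E × E) w = (tensorComponents Ψ p.proj p.proj w.1 + 0,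
    tensorComponentsDeriv Ψ p.proj p.proj p.snd w.1 + tensorComponents Ψ p.proj p.proj w.2) := rfl
  have h2 : (gammaLift cov Ψ hΨ p : E × E →L[ℝ] E × E) w = (0 + 0,
    inCoordinates E (TangentSpace 𝓘(ℝ, E) : M → Type _) E (TangentSpace 𝓘(ℝ, E) : M → Type _)
      p.proj p.proj p.proj p.proj (covariantDerivativeTensor cov Ψ hΨ p.proj p.snd) w.1 + 0) := rfl
  refine (congrArg₂ (fun a b : E × E ↦ a - b) h1 h2).trans ?_
  ext
  · simp
  · simp only [horizontalLiftBlock, Prod.snd_sub, _root_.sub_apply]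
    abel

/-- The matrix of `Ψ^H` in a fixed induced chart has the form that defines `Ψ^H` in the preferred
chart at each point. The second derivatives of the chart transition in the coordinate change of
`TM` cancel against those in the transformation law of the derivative of the components, and `∇Ψ`
is tensorial. -/
theorem inCoordinates_horizontalLift [FiniteDimensional ℝ E]
    (cov : CovariantDerivative 𝓘(ℝ, E) E (TangentSpace 𝓘(ℝ, E) : M → Type _))
    (hΨ : IsSmoothTensorField 𝓘(ℝ, E) Ψ) {p p₀ : TangentBundle 𝓘(ℝ, E) M}
    (hp : p.proj ∈ (chartAt E p₀.proj).source) (w : E × E) :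
    inCoordinates (E × E) (TangentSpace 𝓘(ℝ, E).tangent : TangentBundle 𝓘(ℝ, E) M → Type _)
      (E × E) (TangentSpace 𝓘(ℝ, E).tangent : TangentBundle 𝓘(ℝ, E) M → Type _)
      p₀ p p₀ p (horizontalLift cov Ψ hΨ p) w =
      (tensorComponents Ψ p₀.proj p.proj w.1,
        horizontalLiftBlock cov hΨ p₀.proj p w.1 + tensorComponents Ψ p₀.proj p.proj w.2) := by
  have hpp := mem_chart_source (ModelProd E E) p
  have hpp₀ : p ∈ (chartAt (ModelProd E E) p₀).source :=
    (TangentBundle.mem_chart_source_iff p p₀).2 hp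
  have hxx := mem_chart_source E p.proj
  obtain ⟨u, rfl⟩ : ∃ u : E × E, tangentCoordChange 𝓘(ℝ, E).tangent p p₀ p u = w :=
    ⟨_, tangentCoordChange_tangentCoordChange hpp₀ hpp w⟩
  rw [inCoordinates_tangentCoordChange hpp hpp₀, inCoordinates_tangentSpace_self,
    horizontalLift_apply, tangentCoordChange_tangentBundle p p₀ hp,
    tangentCoordChange_tangentBundle p p₀ hp]
  have hA (h : E) : tensorComponents Ψ p₀.proj p.proj
        (tangentCoordChange 𝓘(ℝ, E) p.proj p₀.proj p.proj h) =
      tangentCoordChange 𝓘(ℝ, E) p.proj p₀.proj p.proj (tensorComponents Ψ p.proj p.proj h) :=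
    inCoordinates_tangentCoordChange hxx hp _ h
  have hD := tensorComponentsDeriv_tangentCoordChange hΨ hp p.snd u.1
  have hN := inCoordinates_tangentCoordChange hxx hp
    (covariantDerivativeTensor cov Ψ hΨ p.proj p.snd) u.1
  refine Prod.ext (hA u.1).symm ?_
  simp only [horizontalLiftBlock, _root_.sub_apply, map_add, map_sub, hA, hN]
  rw [← eq_sub_iff_add_eq] at hD
  rw [hD]
  abel

theorem isSmoothTensorField_horizontalLift [FiniteDimensional ℝ E] [T2Space M]
    {cov : CovariantDerivative 𝓘(ℝ, E) E (TangentSpace 𝓘(ℝ, E) : M → Type _)}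
    (hcov : CovariantDerivative.ContMDiffCovariantDerivative cov ∞)
    (hΨ : IsSmoothTensorField 𝓘(ℝ, E) Ψ) :
    IsSmoothTensorField (M := TangentBundle 𝓘(ℝ, E) M) 𝓘(ℝ, E).tangent
      (horizontalLift cov Ψ hΨ) := by
  intro p₀
  have hpr := contMDiff_proj (n := ∞) (IB := 𝓘(ℝ, E)) (TangentSpace 𝓘(ℝ, E) : M → Type _) p₀
  refine (contMDiffAt_hom_bundle _).2 ⟨contMDiffAt_id, contMDiffAt_clm_of_apply fun w ↦ ?_⟩
  have hA (h : E) := ((hΨ.contMDiffAt_tensorComponents (mem_chart_source E p₀.proj)).comp p₀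
    hpr).clm_apply (contMDiffAt_const (c := h))
  have hC := ((hΨ.contMDiffAt_tensorComponentsDeriv p₀).sub
    (contMDiffAt_inCoordinates_covariantDerivativeTensor hcov hΨ p₀)).clm_apply
      (contMDiffAt_const (c := w.1))
  refine ((hA w.1).prodMk_space (hC.add (hA w.2))).congr_of_eventuallyEq ?_
  filter_upwards [hpr.continuousAt.eventually
    ((chartAt E p₀.proj).open_source.mem_nhds (mem_chart_source E p₀.proj))] with p hp
  exact inCoordinates_horizontalLift cov hΨ hp w

/-- The matrix `(A, 0; C, A)` of `Ψ^H` satisfies the metallic equation because `A` does and because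
`C A + A C = α C`: the two summands of `C` are a coordinate and a covariant derivative of
`Ψ`, and for each of them the identity is the corresponding derivative of `Ψ² = α Ψ + β`. -/
theorem IsMetallicStructure.horizontalLift_apply_apply [FiniteDimensional ℝ E]
    (hΨ : IsMetallicStructure 𝓘(ℝ, E) α β Ψ)
    (cov : CovariantDerivative 𝓘(ℝ, E) E (TangentSpace 𝓘(ℝ, E) : M → Type _))
    (p : TangentBundle 𝓘(ℝ, E) M) (w : TangentSpace 𝓘(ℝ, E).tangent p) :
    horizontalLift cov Ψ hΨ.smooth p (horizontalLift cov Ψ hΨ.smooth p w) -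
      (α : ℝ) • horizontalLift cov Ψ hΨ.smooth p w - (β : ℝ) • w = 0 := by
  have hxx := mem_chart_source E p.proj
  -- The identity is proved for an endomorphism of `E × E`, which `T_p TM` unfolds to.
  have key (L : E × E →L[ℝ] E × E) (hL : ∀ w, L w = (tensorComponents Ψ p.proj p.proj w.1,
      horizontalLiftBlock cov hΨ.smooth p.proj p w.1 + tensorComponents Ψ p.proj p.proj w.2))
      (w : E × E) : L (L w) - (α : ℝ) • L w - (β : ℝ) • w = 0 := by
    have hC : horizontalLiftBlock cov hΨ.smooth p.proj p (tensorComponents Ψ p.proj p.proj w.1) +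
        tensorComponents Ψ p.proj p.proj (horizontalLiftBlock cov hΨ.smooth p.proj p w.1) =
        (α : ℝ) • horizontalLiftBlock cov hΨ.smooth p.proj p w.1 := by
      have hN : inCoordinates E (TangentSpace 𝓘(ℝ, E) : M → Type _) E
            (TangentSpace 𝓘(ℝ, E) : M → Type _) p.proj p.proj p.proj p.proj
            (covariantDerivativeTensor cov Ψ hΨ.smooth p.proj p.snd)
            (tensorComponents Ψ p.proj p.proj w.1) +
          tensorComponents Ψ p.proj p.proj (inCoordinates E (TangentSpace 𝓘(ℝ, E) : M → Type _) E
            (TangentSpace 𝓘(ℝ, E) : M → Type _) p.proj p.proj p.proj p.proj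
            (covariantDerivativeTensor cov Ψ hΨ.smooth p.proj p.snd) w.1) =
          (α : ℝ) • inCoordinates E (TangentSpace 𝓘(ℝ, E) : M → Type _) E
            (TangentSpace 𝓘(ℝ, E) : M → Type _) p.proj p.proj p.proj p.proj
            (covariantDerivativeTensor cov Ψ hΨ.smooth p.proj p.snd) w.1 := by
        obtain ⟨e, -, he⟩ := exists_inCoordinates_eq_conj hxx
        simp only [tensorComponents, he, e.symm_apply_apply, ← map_add, ← map_smul,
          hΨ.covariantDerivativeTensor_anticomm]
      simp only [horizontalLiftBlock, _root_.sub_apply, map_sub, smul_sub, ← hN,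
        ← hΨ.tensorComponentsDeriv_anticomm p.proj p.snd w.1]
      abel
    rw [hL, hL]
    ext
    · simp [hΨ.tensorComponents_apply_apply hxx]
    · simp only [Prod.snd_sub, Prod.smul_snd, map_add, hΨ.tensorComponents_apply_apply hxx,
        smul_add, ← hC, Prod.snd_zero]
      abel
  exact key _ (horizontalLift_apply cov hΨ.smooth p) w

end

theorem theorem5p1 {E : Type*} [NormedAddCommGroup E] [NormedSpace ℝ E] [FiniteDimensional ℝ E]
    {M : Type*} [TopologicalSpace M] [T2Space M] [ChartedSpace E M] [IsManifold 𝓘(ℝ, E) ∞ M]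
    (cov : CovariantDerivative 𝓘(ℝ, E) E (TangentSpace 𝓘(ℝ, E) : M → Type _))
    (hcov : CovariantDerivative.ContMDiffCovariantDerivative cov ∞)
    (α β : ℕ) (Ψ : Π x : M, TangentSpace 𝓘(ℝ, E) x →L[ℝ] TangentSpace 𝓘(ℝ, E) x)
    (hΨ : IsMetallicStructure 𝓘(ℝ, E) α β Ψ) :
    IsMetallicStructure (M := TangentBundle 𝓘(ℝ, E) M) 𝓘(ℝ, E).tangent α β
      (horizontalLift cov Ψ hΨ.smooth) :=
  ⟨hΨ.alpha_pos, hΨ.beta_pos, isSmoothTensorField_horizontalLift hcov hΨ.smooth,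
    fun p ↦ ContinuousLinearMap.ext fun w ↦ hΨ.horizontalLift_apply_apply cov p w⟩
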